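/- Let $n\ge 3$, let $a_1,\dots,a_n>0$ (indices modulo $n$), and let $A\in\mathbb R^{n\times n}$ be the $n$-dimensional RPS matrix: $A_{i,i+1}=-a_i$, $A_{i,i-1}=a_{i-1}$, and $A_{i,j}=0$ otherwise. Put $a_{\min}=\min_i a_i$ and, for $x$ in the simplex $\Delta_n$, $$\gamma(x)=\min_{k\neq \ell}\bigl|(a_{k-1}x_{k-1}-a_kx_{k+1})-(a_{\ell-1}x_{\ell-1}-a_\ell x_{\ell+1})\bigr| .$$ For $x^0\in\Delta_n$ and $\eta>0$, the iterates of Gradient Descent are given by $y^0=0$ and, for $t\ge 0$, $$y^{t+1}=y^t+\eta Ax^t,\qquad x^{t+1}=\operatorname*{arg\,max}_{x\in\Delta_n}\ \langle x,y^{t+1}\rangle-\tfrac12\|x\|_2^2 .$$ Let $\mathrm{Reg}(T)$ be the total regret of the two players of the zero-sum game $A$ when both play $x^t$ in rounds $t=0,\dots,T$, that is, $\mathrm{Reg}(T)=\mathrm{Reg}_1(T)+\mathrm{Reg}_2(T)$ with $$\mathrm{Reg}_1(T)=\max_{x\in\Delta_n}\sum_{t=0}^T\langle x,Ax^t\rangle-\sum_{t=0}^T\langle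 x^t,Ax^t\rangle,\qquad \mathrm{Reg}_2(T)=\sum_{t=0}^T\langle x^t,Ax^t\rangle-\min_{x\in\Delta_n}\sum_{t=0}^T\langle x,A^\top x^t\rangle$$ (equivalently, $\mathrm{Reg}(T)=2\max_{x\in\Delta_n}\sum_{t=0}^T\langle x,Ax^t\rangle$, as $A$ is skew-symmetric). Then $\gamma(x^0)>0$ for almost every $x^0\in\Delta_n$: the set $\{x\in\Delta_n:\gamma(x)=0\}$ has $(n-1)$-dimensional Hausdorff (equivalently, Lebesgue) measure zero. Moreover, for every $\eta$ there is a constant $C$, depending only on $A$ and $\eta$, such that for every $x^0\in\Delta_n$ with $\gamma(x^0)>0$ and $$\eta>\max\{2/a_{\min},\,1/\gamma(x^0)\},$$ the iterates of Gradient Descent on $A$ started at $x^0$ with stepsize $\eta$ satisfy $\mathrm{Reg}(T)\le C\sqrt T$ for all $T\ge 1$. -/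

import Mathlib

open MeasureTheory
open scoped Matrix

noncomputable section

namespace RPS

/-- The probability simplex `Δ_n` of mixed strategies. -/
abbrev simplex (n : ℕ) : Set (Fin n → ℝ) := stdSimplex ℝ (Fin n)

/-- The `n`-dimensional rock-paper-scissors payoff matrix with constants `a` (used for `3 ≤ n`).
Indices live in `Fin n`, whose addition and subtraction are modulo `n`. -/
def rpsMatrix {n : ℕ} [NeZero n] (a : Fin n → ℝ) : Matrix (Fin n) (Fin n) ℝ :=
  Matrix.of fun i j =>
    if j = i + 1 then -a i
    else if j = i - 1 then a (i - 1)
    else 0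

/-- The smallest of the constants `a_i`. -/
def aMin {n : ℕ} (a : Fin n → ℝ) : ℝ := ⨅ i, a i

/-- `γ(x)`: the minimum over `k ≠ ℓ` of
`|(a_{k-1} x_{k-1} - a_k x_{k+1}) - (a_{ℓ-1} x_{ℓ-1} - a_ℓ x_{ℓ+1})|`. -/
def gamma {n : ℕ} [NeZero n] (a x : Fin n → ℝ) : ℝ :=
  ⨅ p : {p : Fin n × Fin n // p.1 ≠ p.2},
    |(a (p.1.1 - 1) * x (p.1.1 - 1) - a p.1.1 * x (p.1.1 + 1))
      - (a (p.1.2 - 1) * x (p.1.2 - 1) - a p.1.2 * x (p.1.2 + 1))|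

/-- `x` and `y` are the primal and dual iterates of Gradient Descent (follow the regularized leader
with regularizer `‖x‖₂² / 2`) in symmetric learning on the payoff matrix `A`, with constant stepsize
`η` and initial strategy `x0`. -/
structure IsGradientDescent {n : ℕ} (A : Matrix (Fin n) (Fin n) ℝ) (η : ℝ) (x0 : Fin n → ℝ)
    (x y : ℕ → Fin n → ℝ) : Prop where
  primal_zero : x 0 = x0
  dual_zero : y 0 = 0
  dual_succ : ∀ t, y (t + 1) = y t + η • (A *ᵥ x t)
  primal_mem : ∀ t, x (t + 1) ∈ simplex n
  primal_max : ∀ t, IsMaxOn (fun u : Fin n → ℝ => u ⬝ᵥ y (t + 1) - (∑ i, u i ^ 2) / 2)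
    (simplex n) (x (t + 1))

/-- Regret of the row player (who maximizes `⟨x₁, A x₂⟩`) over the rounds `0, …, T`. -/
def regret₁ {m n : ℕ} (A : Matrix (Fin m) (Fin n) ℝ) (x₁ : ℕ → Fin m → ℝ) (x₂ : ℕ → Fin n → ℝ)
    (T : ℕ) : ℝ :=
  sSup ((fun u : Fin m → ℝ => ∑ t ∈ Finset.range (T + 1), u ⬝ᵥ (A *ᵥ x₂ t)) '' simplex m)
    - ∑ t ∈ Finset.range (T + 1), x₁ t ⬝ᵥ (A *ᵥ x₂ t)

/-- Regret of the column player (who minimizes `⟨x₁, A x₂⟩`) over the rounds `0, …, T`. -/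
def regret₂ {m n : ℕ} (A : Matrix (Fin m) (Fin n) ℝ) (x₁ : ℕ → Fin m → ℝ) (x₂ : ℕ → Fin n → ℝ)
    (T : ℕ) : ℝ :=
  (∑ t ∈ Finset.range (T + 1), x₁ t ⬝ᵥ (A *ᵥ x₂ t))
    - sInf ((fun u : Fin n → ℝ => ∑ t ∈ Finset.range (T + 1), u ⬝ᵥ (Aᵀ *ᵥ x₁ t)) '' simplex n)

/-- Total regret of the two players. -/
def totalRegret {m n : ℕ} (A : Matrix (Fin m) (Fin n) ℝ) (x₁ : ℕ → Fin m → ℝ)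
    (x₂ : ℕ → Fin n → ℝ) (T : ℕ) : ℝ :=
  regret₁ A x₁ x₂ T + regret₂ A x₁ x₂ T

end RPS

end

/-!
Write `y` for the dual iterates and `L = η · max a`. Two facts carry the regret bound.

*The play cycles through the vertices.* Call `y` *cyclic at `j`* if every coordinate other than `j`
and `j + 1` lies at least `1` below `y j`. The quadratic regularizer then only gives mass to `j` and
`j + 1`. As long as `y (j + 1) ≤ y j - 1` the whole mass is on `j`, only coordinate `j + 1` rises
and `y j` is constant; once `y (j + 1) > y j - 1`, a single step makes `y` cyclic at `j + 1`,
because `η a_j > 2`. The value at the current leader never decreases, and it grows by at most `2 L`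
at each change of leader (`Cyclic.step`). The condition `η γ(x⁰) > 1` says that the first dual
iterate is cyclic at its largest coordinate.

*Changes of leader are rare when the leading value is high.* The dual iterate is `η A w` with
`w` the sum of the strategies played, and `⟨w, A w⟩ = 0` with `w ≥ 0`, so some coordinate of `y` is
`≤ 0` at every time (`exists_mulVec_nonpos`). Within `n` changes of leader that coordinate has to
lead, and no coordinate rises by more than `L` per round; hence `n` changes of leader take at least
`u / L` rounds if `u` is the leading value at their start, while `u` grows by at most `2 n L`.
So `u²` grows at most linearly in time (`leader_sq_le`). The regret is `2 / η` times the largest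
dual coordinate, which exceeds `u` by at most `L`.

For the null set: `γ(x) = 0` forces `(A x)_k = (A x)_ℓ` for some `k ≠ ℓ`. Row `k` minus row `ℓ` of
`A` is negative at `k + 1` and positive at `ℓ + 1`, so it is not a multiple of the all-ones vector,
and the equation cuts the simplex in a set of dimension at most `n - 2`.
-/

namespace RPS

/-! ### The rock-paper-scissors matrix -/

theorem add_one_ne_self {n : ℕ} [NeZero n] (hn : 3 ≤ n) (i : Fin n) : i + 1 ≠ i := by
  intro h
  have h1 : (1 : Fin n) = 0 := by simpa using h
  have := congrArg Fin.val h1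
  rw [Fin.val_one', Fin.val_zero, Nat.mod_eq_of_lt (by omega)] at this
  omega

theorem add_one_ne_sub_one {n : ℕ} [NeZero n] (hn : 3 ≤ n) (i : Fin n) : i + 1 ≠ i - 1 := by
  intro h
  have h1 : (1 : Fin n) + 1 = 0 := by
    have h2 : i + (1 + 1) = i + 0 := by
      rw [← add_assoc, h]; simp
    exact add_left_cancel h2
  have := congrArg Fin.val h1
  rw [Fin.val_add, Fin.val_one', Fin.val_zero, Nat.mod_eq_of_lt (by omega : 1 < n),
    Nat.mod_eq_of_lt (by omega)] at this
  omega

theorem mulVec_apply {n : ℕ} [NeZero n] (hn : 3 ≤ n) (a x : Fin n → ℝ) (k : Fin n) :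
    (rpsMatrix a *ᵥ x) k = a (k - 1) * x (k - 1) - a k * x (k + 1) := by
  have h : ∀ j, rpsMatrix a k j * x j
      = (if j = k + 1 then -a k * x j else 0) + (if j = k - 1 then a (k - 1) * x j else 0) := by
    intro j
    have hne := add_one_ne_sub_one hn k
    by_cases h1 : j = k + 1
    · subst h1
      simp [rpsMatrix, hne]
    · simp [rpsMatrix, h1]
  simp only [Matrix.mulVec, dotProduct, h, Finset.sum_add_distrib, Finset.sum_ite_eq',
    Finset.mem_univ, if_true]
  ring

/-- Skew-symmetry of the payoff matrix, as the vanishing of its quadratic form. -/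
theorem dotProduct_mulVec_self {n : ℕ} [NeZero n] (hn : 3 ≤ n) (a w : Fin n → ℝ) :
    w ⬝ᵥ (rpsMatrix a *ᵥ w) = 0 := by
  simp only [dotProduct, mulVec_apply hn, mul_sub, Finset.sum_sub_distrib]
  rw [sub_eq_zero, ← Equiv.sum_comp (Equiv.addRight (1 : Fin n))]
  refine Finset.sum_congr rfl fun i _ => ?_
  simp only [Equiv.coe_addRight, add_sub_cancel_right]
  ring

theorem transpose_rpsMatrix {n : ℕ} [NeZero n] (hn : 3 ≤ n) (a : Fin n → ℝ) :
    (rpsMatrix a)ᵀ = -rpsMatrix a := by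
  ext i j
  have hi := add_one_ne_sub_one hn i
  have hj := add_one_ne_sub_one hn j
  by_cases h1 : j = i + 1
  · subst h1
    have h2 : i ≠ i + 1 + 1 := by simpa using hj.symm
    simp [rpsMatrix, h2]
  · by_cases h2 : i = j + 1
    · subst h2
      simp [rpsMatrix, h1]
    · have h3 : j ≠ i - 1 := fun h => h2 (by simp [h])
      have h4 : i ≠ j - 1 := fun h => h1 (by simp [h])
      simp [rpsMatrix, h1, h2, h3, h4]

/-- A nonnegative nonzero `w` cannot make all payoffs positive: `⟨w, A w⟩ = 0`. -/
theorem exists_mulVec_nonpos {n : ℕ} [NeZero n] (hn : 3 ≤ n) (a w : Fin n → ℝ)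
    (hw : ∀ i, 0 ≤ w i) (hs : 0 < ∑ i, w i) : ∃ k, (rpsMatrix a *ᵥ w) k ≤ 0 := by
  by_contra! h
  obtain ⟨i, -, hi⟩ := Finset.exists_lt_of_sum_lt (s := Finset.univ) (f := fun _ => (0 : ℝ))
    (g := w) (by simpa using hs)
  have : 0 < w ⬝ᵥ (rpsMatrix a *ᵥ w) :=
    Finset.sum_pos' (fun k _ => mul_nonneg (hw k) (h k).le)
      ⟨i, Finset.mem_univ _, mul_pos hi (h i)⟩
  exact this.ne' (dotProduct_mulVec_self hn a w)

theorem exists_mulVec_nonneg {n : ℕ} [NeZero n] (hn : 3 ≤ n) (a w : Fin n → ℝ)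
    (hw : ∀ i, 0 ≤ w i) (hs : 0 < ∑ i, w i) : ∃ k, 0 ≤ (rpsMatrix a *ᵥ w) k := by
  obtain ⟨k, hk⟩ := exists_mulVec_nonpos hn (-a) w hw hs
  rw [mulVec_apply hn] at hk
  exact ⟨k, by rw [mulVec_apply hn]; simp only [Pi.neg_apply] at hk; linarith⟩

theorem mulVec_le {n : ℕ} [NeZero n] (hn : 3 ≤ n) {a x : Fin n → ℝ} (ha : ∀ i, 0 < a i)
    (hx : x ∈ simplex n) (k : Fin n) :
    (rpsMatrix a *ᵥ x) k ≤ a (k - 1) * x (k - 1) := by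
  rw [mulVec_apply hn]
  linarith [mul_nonneg (ha k).le (hx.1 (k + 1))]

theorem gamma_eq {n : ℕ} [NeZero n] (hn : 3 ≤ n) (a x : Fin n → ℝ) :
    gamma a x = ⨅ p : {p : Fin n × Fin n // p.1 ≠ p.2},
      |(rpsMatrix a *ᵥ x) p.1.1 - (rpsMatrix a *ᵥ x) p.1.2| := by
  simp only [mulVec_apply hn, gamma]

/-! ### The set where `γ` vanishes -/

theorem hausdorffMeasure_hyperplane_slice {n : ℕ} (hn : 1 ≤ n)
    (f : EuclideanSpace ℝ (Fin n) →ₗ[ℝ] ℝ) (v : EuclideanSpace ℝ (Fin n))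
    (hv : ∑ i, v i = 0) (hfv : f v ≠ 0) :
    Measure.hausdorffMeasure ((n : ℝ) - 1)
      {x : EuclideanSpace ℝ (Fin n) | ∑ i, x i = 1 ∧ f x = 0} = 0 := by
  set S := {x : EuclideanSpace ℝ (Fin n) | ∑ i, x i = 1 ∧ f x = 0} with hS
  rcases S.eq_empty_or_nonempty with h | ⟨x0, hx0⟩
  · rw [h]; simp
  let g : EuclideanSpace ℝ (Fin n) →ₗ[ℝ] ℝ :=
    { toFun := fun x => ∑ i, x i
      map_add' := fun x y => by simp [Finset.sum_add_distrib]
      map_smul' := fun c x => by simp [Finset.mul_sum] }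
  let W : Submodule ℝ (EuclideanSpace ℝ (Fin n)) := LinearMap.ker g ⊓ LinearMap.ker f
  have h1 : W < LinearMap.ker g :=
    lt_of_le_of_ne inf_le_left fun h => hfv ((h.ge (show v ∈ LinearMap.ker g from hv)).2)
  have h2 : LinearMap.ker g < ⊤ := by
    refine lt_top_iff_ne_top.2 fun h => ?_
    have : g x0 = 0 := by
      have hm : x0 ∈ LinearMap.ker g := h ▸ Submodule.mem_top
      exact hm
    have h' : g x0 = 1 := hx0.1
    linarith
  have h3 := Submodule.finrank_lt_finrank_of_lt h1
  have h4 := Submodule.finrank_lt_finrank_of_lt h2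
  rw [finrank_top, finrank_euclideanSpace_fin] at h4
  have hsub : S ⊆ (fun w : W => x0 + (w : EuclideanSpace ℝ (Fin n))) '' Set.univ := by
    intro x hx
    have hg : g (x - x0) = 0 := by
      rw [map_sub, show g x = 1 from hx.1, show g x0 = 1 from hx0.1, sub_self]
    have hf : f (x - x0) = 0 := by rw [map_sub, hx.2, hx0.2, sub_self]
    exact ⟨⟨x - x0, hg, hf⟩, trivial, by simp⟩
  have hiso : Isometry (fun w : W => x0 + (w : EuclideanSpace ℝ (Fin n))) :=
    (IsometryEquiv.addLeft x0).isometry.comp isometry_subtype_coe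
  have hdim : dimH S < ((n - 1 : ℕ) : NNReal) := by
    refine (dimH_mono hsub).trans_lt ?_
    rw [hiso.dimH_image, Real.dimH_univ_eq_finrank]
    have : Module.finrank ℝ W < n - 1 := by omega
    exact_mod_cast this
  have := hausdorffMeasure_of_dimH_lt hdim
  rwa [NNReal.coe_natCast, Nat.cast_sub hn, Nat.cast_one] at this

theorem rpsMatrix_nonneg_of_ne {n : ℕ} [NeZero n] {a : Fin n → ℝ} (ha : ∀ i, 0 < a i)
    {i j : Fin n} (h : j ≠ i + 1) : 0 ≤ rpsMatrix a i j := by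
  simp only [rpsMatrix, Matrix.of_apply, if_neg h]
  split_ifs
  exacts [(ha _).le, le_rfl]

theorem hausdorffMeasure_gamma_eq_zero {n : ℕ} [NeZero n] (hn : 3 ≤ n) (a : Fin n → ℝ)
    (ha : ∀ i, 0 < a i) :
    Measure.hausdorffMeasure ((n : ℝ) - 1)
      {x : EuclideanSpace ℝ (Fin n) | x.ofLp ∈ simplex n ∧ ¬ 0 < gamma a x.ofLp} = 0 := by
  let f (p : {p : Fin n × Fin n // p.1 ≠ p.2}) : EuclideanSpace ℝ (Fin n) →ₗ[ℝ] ℝ :=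
    { toFun := fun x => (rpsMatrix a *ᵥ x.ofLp) p.1.1 - (rpsMatrix a *ᵥ x.ofLp) p.1.2
      map_add' := fun x y => by simp [Matrix.mulVec_add]; ring
      map_smul' := fun c x => by simp [Matrix.mulVec_smul]; ring }
  have hsub : {x : EuclideanSpace ℝ (Fin n) | x.ofLp ∈ simplex n ∧ ¬ 0 < gamma a x.ofLp} ⊆
      ⋃ p, {x : EuclideanSpace ℝ (Fin n) | ∑ i, x i = 1 ∧ f p x = 0} := by
    rintro x ⟨hx, hγ⟩
    have : Nonempty {p : Fin n × Fin n // p.1 ≠ p.2} :=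
      ⟨⟨(0 + 1, 0), add_one_ne_self hn 0⟩⟩
    obtain ⟨p, hp⟩ := exists_eq_ciInf_of_finite
      (f := fun p : {p : Fin n × Fin n // p.1 ≠ p.2} =>
        |(rpsMatrix a *ᵥ x.ofLp) p.1.1 - (rpsMatrix a *ᵥ x.ofLp) p.1.2|)
    rw [gamma_eq hn, ← hp, abs_pos, not_not] at hγ
    exact Set.mem_iUnion.2 ⟨p, hx.2, hγ⟩
  refine measure_mono_null hsub (measure_iUnion_null fun p => ?_)
  obtain ⟨⟨k, l⟩, hkl⟩ := p
  have hkl' : k + 1 ≠ l + 1 := fun h => hkl (add_right_cancel h)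
  refine hausdorffMeasure_hyperplane_slice (by omega) _
    (EuclideanSpace.single (k + 1) 1 - EuclideanSpace.single (l + 1) 1) ?_ ?_
  · simp [Finset.sum_sub_distrib]
  · have h1 := rpsMatrix_nonneg_of_ne ha (i := l) hkl'
    have h2 := rpsMatrix_nonneg_of_ne ha (i := k) hkl'.symm
    have h3 : rpsMatrix a k (k + 1) = -a k := by simp [rpsMatrix]
    have h4 : rpsMatrix a l (l + 1) = -a l := by simp [rpsMatrix]
    have h5 := ha k
    have h6 := ha l
    simp only [f, LinearMap.coe_mk, AddHom.coe_mk, WithLp.ofLp_sub, PiLp.ofLp_single,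
      Matrix.mulVec_sub, Matrix.mulVec_single_one, Pi.sub_apply, Matrix.col_apply]
    rw [h3, h4]
    exact ne_of_lt (by linarith)

/-! ### The regularized best response -/

/-- Optimality condition of the regularized best response: mass moved from a coordinate `k` of the
support to `i` does not increase the first-order gain. -/
theorem sub_le_sub_of_isMaxOn {n : ℕ} {x y : Fin n → ℝ} (hx : x ∈ simplex n)
    (hmax : IsMaxOn (fun u : Fin n → ℝ => u ⬝ᵥ y - (∑ i, u i ^ 2) / 2) (simplex n) x)
    {k : Fin n} (i : Fin n) (hk : 0 < x k) : y i - x i ≤ y k - x k := by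
  rcases eq_or_ne i k with rfl | hik
  · exact le_rfl
  by_contra! hlt
  set g := (y i - x i) - (y k - x k) with hg
  -- The objective changes by `ε g - ε²` along the exchange; `ε ≤ g / 2` makes this positive.
  set ε := min (x k) (g / 2) with hε
  have hε0 : 0 < ε := lt_min hk (by linarith)
  have hε1 : ε ≤ x k := min_le_left _ _
  have hε2 : ε ≤ g / 2 := min_le_right _ _
  let v : Fin n → ℝ := x + ε • (Pi.single i 1 - Pi.single k 1)
  have hvi : ∀ j, v j = x j + ε * ((Pi.single i 1 : Fin n → ℝ) j - (Pi.single k 1 : Fin n → ℝ) j) :=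
    fun j => by simp [v]
  have hv : v ∈ simplex n := by
    refine ⟨fun j => ?_, ?_⟩
    · rw [hvi]
      have := hx.1 j
      by_cases hj : j = k
      · subst hj; simp [hik.symm]; linarith
      · by_cases hj' : j = i
        · subst hj'; simp [hj]; linarith
        · simpa [hj, hj'] using this
    · simp only [hvi, Finset.sum_add_distrib, ← Finset.mul_sum, Finset.sum_sub_distrib]
      simp [hx.2]
  have h := hmax hv
  simp only [Set.mem_ofPred_eq] at h
  have e1 : v ⬝ᵥ y = x ⬝ᵥ y + ε * (y i - y k) := by
    simp [v, add_dotProduct, smul_dotProduct, sub_dotProduct]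
  have e2 : ∑ j, v j ^ 2 = ∑ j, x j ^ 2 + 2 * ε * (x i - x k) + 2 * ε ^ 2 := by
    have : ∑ j, v j ^ 2 = v ⬝ᵥ v := by simp [dotProduct, sq]
    rw [this]
    have h2 : ∑ j, x j ^ 2 = x ⬝ᵥ x := by simp [dotProduct, sq]
    rw [h2]
    simp [v, add_dotProduct, smul_dotProduct, sub_dotProduct, dotProduct_add, dotProduct_smul,
      dotProduct_sub, hik, hik.symm]
    ring
  rw [e1, e2] at h
  nlinarith

/-! ### Cyclic dual vectors -/

/-- The dual vector `y` is cyclic at `j` (the leader), with tolerance `L`: only `j` and its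
successor can be played by the regularized best response, and the successor exceeds the leader by
at most `L`. -/
structure Cyclic {n : ℕ} [NeZero n] (L : ℝ) (j : Fin n) (y : Fin n → ℝ) : Prop where
  succ_le : y (j + 1) ≤ y j + L
  le_sub_one : ∀ k, k ≠ j → k ≠ j + 1 → y k ≤ y j - 1

theorem Cyclic.le {n : ℕ} [NeZero n] {L : ℝ} {j : Fin n} {y : Fin n → ℝ} (h : Cyclic L j y)
    (hL : 0 ≤ L) (k : Fin n) : y k ≤ y j + L := by
  by_cases h1 : k = j
  · subst h1; linarith
  by_cases h2 : k = j + 1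
  · subst h2; exact h.succ_le
  linarith [h.le_sub_one k h1 h2]

theorem Cyclic.eq_zero {n : ℕ} [NeZero n] {L : ℝ} {j : Fin n} {x y : Fin n → ℝ}
    (h : Cyclic L j y) (hx : x ∈ simplex n)
    (hmax : IsMaxOn (fun u : Fin n → ℝ => u ⬝ᵥ y - (∑ i, u i ^ 2) / 2) (simplex n) x)
    {k : Fin n} (h1 : k ≠ j) (h2 : k ≠ j + 1) : x k = 0 := by
  by_contra hk
  have hk' : 0 < x k := lt_of_le_of_ne (hx.1 k) (Ne.symm hk)
  have := sub_le_sub_of_isMaxOn hx hmax j hk'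
  have h3 := h.le_sub_one k h1 h2
  have h4 : x j ≤ 1 := (mem_Icc_of_mem_stdSimplex hx j).2
  linarith

theorem Cyclic.add_eq_one {n : ℕ} [NeZero n] (hn : 3 ≤ n) {L : ℝ} {j : Fin n} {x y : Fin n → ℝ}
    (h : Cyclic L j y) (hx : x ∈ simplex n)
    (hmax : IsMaxOn (fun u : Fin n → ℝ => u ⬝ᵥ y - (∑ i, u i ^ 2) / 2) (simplex n) x) :
    x j + x (j + 1) = 1 := by
  rw [← hx.2, ← Finset.sum_pair (add_one_ne_self hn j).symm]
  refine Finset.sum_subset (Finset.subset_univ _) fun k _ hk => ?_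
  simp only [Finset.mem_insert, Finset.mem_singleton, not_or] at hk
  exact h.eq_zero hx hmax hk.1 hk.2

/-- One step of Gradient Descent from a dual vector that is cyclic at `j`: either the leader and its
value stay, or `j + 1` becomes the leader. -/
theorem Cyclic.step {n : ℕ} [NeZero n] (hn : 3 ≤ n) {a : Fin n → ℝ} (ha : ∀ i, 0 < a i)
    {η L : ℝ} (hη : 0 < η) (hstep : ∀ i, 2 ≤ η * a i) (hL : ∀ i, η * a i ≤ L)
    {j : Fin n} {x y : Fin n → ℝ} (h : Cyclic L j y) (hx : x ∈ simplex n)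
    (hmax : IsMaxOn (fun u : Fin n → ℝ => u ⬝ᵥ y - (∑ i, u i ^ 2) / 2) (simplex n) x) :
    let y' := y + η • (rpsMatrix a *ᵥ x)
    (Cyclic L j y' ∧ y' j = y j) ∨
      (Cyclic L (j + 1) y' ∧ y j ≤ y' (j + 1) ∧ y' (j + 1) ≤ y j + 2 * L) := by
  intro y'
  have hsum := h.add_eq_one hn hx hmax
  have hne := add_one_ne_self hn j
  have hpred : x (j - 1) = 0 := h.eq_zero hx hmax
    (fun e => hne (eq_add_of_sub_eq e).symm) (add_one_ne_sub_one hn j).symm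
  have hsucc : x (j + 1 + 1) = 0 := h.eq_zero hx hmax
    (fun e => add_one_ne_sub_one hn (j + 1) (by simp [e])) (add_one_ne_self hn (j + 1))
  have hx0 := hx.1 j
  have hx1 := hx.1 (j + 1)
  have hy' : ∀ k, y' k = y k + η * (rpsMatrix a *ᵥ x) k := fun k => by simp [y']
  have ej : y' j = y j - η * a j * x (j + 1) := by
    rw [hy', mulVec_apply hn, hpred]; ring
  have es : y' (j + 1) = y (j + 1) + η * a j * x j := by
    rw [hy', mulVec_apply hn, hsucc, add_sub_cancel_right]; ring
  have hle : ∀ k, y' k ≤ y k + η * a (k - 1) * x (k - 1) := fun k => by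
    rw [hy', mul_assoc]
    have := mul_le_mul_of_nonneg_left (mulVec_le hn ha hx k) hη.le
    linarith
  have hLj := hL j
  have hsj := hstep j
  by_cases hd : y (j + 1) ≤ y j - 1
  · left
    have hz : x (j + 1) = 0 := by
      by_contra hk
      have := sub_le_sub_of_isMaxOn hx hmax j (lt_of_le_of_ne hx1 (Ne.symm hk))
      have : 0 < x (j + 1) := lt_of_le_of_ne hx1 (Ne.symm hk)
      linarith
    have e0 : y' j = y j := by rw [ej, hz]; ring
    refine ⟨⟨?_, fun k h1 h2 => ?_⟩, e0⟩
    · have hxj : x j = 1 := by linarith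
      rw [es, e0, hxj]; linarith
    · have hk : x (k - 1) = 0 := by
        by_cases h3 : k - 1 = j + 1
        · rw [h3, hz]
        · exact h.eq_zero hx hmax (fun e => h2 (by rw [← e]; simp)) h3
      have := hle k
      rw [hk] at this
      linarith [h.le_sub_one k h1 h2]
  · right
    push Not at hd
    -- The mixture of `j` and `j + 1` is such that `y (j + 1) - y j ≥ x (j + 1) - x j`.
    have hdx : 1 - 2 * x j ≤ y (j + 1) - y j := by
      rcases hx1.eq_or_lt with hz | hpos
      · linarith
      · linarith [sub_le_sub_of_isMaxOn hx hmax j hpos]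
    have hlow : y j + 1 ≤ y' (j + 1) := by
      rw [es]; nlinarith
    have hxj1 : η * a j * x j ≤ L := by nlinarith
    refine ⟨⟨?_, fun k h1 h2 => ?_⟩, by linarith, by rw [es]; linarith [h.succ_le]⟩
    · have h1 := h.le_sub_one (j + 1 + 1)
        (fun e => add_one_ne_sub_one hn (j + 1) (by simp [e])) (add_one_ne_self hn (j + 1))
      have h2 := hle (j + 1 + 1)
      rw [add_sub_cancel_right] at h2
      have h3 : η * a (j + 1) * x (j + 1) ≤ L := by
        have := hL (j + 1)
        have := hstep (j + 1)
        nlinarith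
      linarith
    · by_cases hkj : k = j
      · subst hkj
        rw [ej, es]
        have : η * a k * x k + η * a k * x (k + 1) = η * a k := by
          rw [← mul_add, hsum, mul_one]
        linarith
      · have hk : x (k - 1) = 0 := h.eq_zero hx hmax (fun e => h1 (by rw [← e]; simp))
          (fun e => h2 (by rw [← e]; simp))
        have := hle k
        rw [hk] at this
        linarith [h.le_sub_one k hkj h1]

/-! ### Growth of the leading value -/

theorem exists_eq_of_step_le_one {c : ℕ → ℕ} (hc : ∀ t, c (t + 1) = c t ∨ c (t + 1) = c t + 1)
    {s T v : ℕ} (hsT : s ≤ T) (h1 : c s ≤ v) (h2 : v ≤ c T) : ∃ r, s ≤ r ∧ r ≤ T ∧ c r = v := by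
  induction T, hsT using Nat.le_induction with
  | base => exact ⟨s, le_rfl, le_rfl, le_antisymm h1 h2⟩
  | succ T hT ih =>
    rcases lt_or_ge (c T) v with h | h
    · refine ⟨T + 1, by omega, le_rfl, ?_⟩
      rcases hc T with h3 | h3 <;> omega
    · obtain ⟨r, h3, h4, h5⟩ := ih h
      exact ⟨r, h3, by omega, h5⟩

/-- The leading value of a vector-valued sequence grows at most like the square root of time, if
the leader runs cyclically through the coordinates, the leading value changes only with the leader,
no coordinate rises fast, and some coordinate is nonpositive at all times. The number `c t` counts
the changes of leader, with an offset that makes the leader `c t` modulo `n`. -/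
theorem leader_sq_le {n : ℕ} [NeZero n] {L : ℝ} (hL : 0 ≤ L) {y : ℕ → Fin n → ℝ} {c : ℕ → ℕ}
    (hstep : ∀ t, (c (t + 1) = c t ∧ y (t + 1) (Fin.ofNat n (c t)) = y t (Fin.ofNat n (c t))) ∨
      (c (t + 1) = c t + 1 ∧ y t (Fin.ofNat n (c t)) ≤ y (t + 1) (Fin.ofNat n (c (t + 1))) ∧
        y (t + 1) (Fin.ofNat n (c (t + 1))) ≤ y t (Fin.ofNat n (c t)) + 2 * L))
    (hrise : ∀ t k, y (t + 1) k ≤ y t k + L) (hnonpos : ∀ t, ∃ k, y t k ≤ 0)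
    (h0 : 0 ≤ y 0 (Fin.ofNat n (c 0))) (h0L : y 0 (Fin.ofNat n (c 0)) ≤ L) (T : ℕ) :
    0 ≤ y T (Fin.ofNat n (c T)) ∧
      y T (Fin.ofNat n (c T)) ^ 2 ≤ ((2 * n + 1) * L) ^ 2 * (T + 1) := by
  set u : ℕ → ℝ := fun t => y t (Fin.ofNat n (c t)) with hu
  have hc : ∀ t, c (t + 1) = c t ∨ c (t + 1) = c t + 1 := fun t =>
    (hstep t).imp And.left And.left
  have hmono : Monotone u := by
    refine monotone_nat_of_le_succ fun t => ?_
    rcases hstep t with ⟨h1, h2⟩ | ⟨-, h2, -⟩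
    · simp only [hu, h1]; exact h2.ge
    · exact h2
  have hgrow : ∀ s T, s ≤ T → u T ≤ u s + 2 * L * ((c T : ℝ) - c s) := by
    intro s T hsT
    induction T, hsT using Nat.le_induction with
    | base => simp
    | succ T hT ih =>
      rcases hstep T with ⟨h1, h2⟩ | ⟨h1, -, h2⟩
      · have : u (T + 1) = u T := by simp only [hu, h1]; exact h2
        rw [this, h1]; exact ih
      · have : u (T + 1) ≤ u T + 2 * L := h2
        rw [h1]; push_cast; linarith
  have hriseN : ∀ k s T, s ≤ T → y T k ≤ y s k + L * ((T : ℝ) - s) := by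
    intro k s T hsT
    induction T, hsT using Nat.le_induction with
    | base => simp
    | succ T hT ih => push_cast; linarith [hrise T k]
  have hnn : ∀ t, 0 ≤ u t := fun t => h0.trans (hmono (Nat.zero_le t))
  refine ⟨hnn T, ?_⟩
  change u T ^ 2 ≤ _
  have hn0 : 0 < n := Nat.pos_of_neZero n
  induction T using Nat.strong_induction_on with
  | _ T ih =>
    rcases lt_or_ge (c T) (c 0 + n) with hT | hT
    · have h1 := hgrow 0 T (Nat.zero_le T)
      have h2 : (c T : ℝ) - c 0 ≤ n := by
        have : (c T : ℝ) ≤ c 0 + n := by exact_mod_cast hT.le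
        linarith
      have h3 : u T ≤ (2 * n + 1) * L := by
        have : u 0 ≤ L := h0L
        nlinarith
      have h4 : u T ^ 2 ≤ ((2 * n + 1) * L) ^ 2 := pow_le_pow_left₀ (hnn T) h3 2
      have h5 : (0 : ℝ) ≤ T := Nat.cast_nonneg T
      nlinarith [sq_nonneg ((2 * n + 1) * L)]
    · -- Compare with a time `s` lying exactly `n` changes of leader before `T`.
      obtain ⟨s, -, hsT, hs⟩ := exists_eq_of_step_le_one hc (Nat.zero_le T)
        (show c 0 ≤ c T - n by omega) (by omega)
      have hlt : s < T := by
        rcases hsT.eq_or_lt with h | h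
        · subst h; omega
        · exact h
      obtain ⟨k, hk⟩ := hnonpos s
      obtain ⟨m, hm, hmk⟩ : ∃ m < n, Fin.ofNat n (c s + m) = k := by
        refine ⟨(k - Fin.ofNat n (c s)).val, Fin.is_lt _, ?_⟩
        have : Fin.ofNat n (c s + (k - Fin.ofNat n (c s)).val)
            = Fin.ofNat n (c s) + (k - Fin.ofNat n (c s)) := by
          refine Fin.ext ?_
          rw [Fin.val_add]
          exact (Nat.mod_add_mod _ _ _).symm
        rw [this]; simp
      obtain ⟨r, hsr, hrT, hr⟩ := exists_eq_of_step_le_one hc hsT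
        (show c s ≤ c s + m by omega) (by omega)
      have h1 : u s ≤ L * ((T : ℝ) - s) := by
        have h2 : u r = y r k := by simp only [hu, hr, hmk]
        have h3 := hriseN k s r hsr
        have h4 := hmono hsr
        have h5 : (r : ℝ) ≤ T := by exact_mod_cast hrT
        nlinarith
      have h2 : u T ≤ u s + 2 * n * L := by
        have h3 := hgrow s T hsT
        have h4 : (c T : ℝ) = c s + n := by
          have : c T = c s + n := by omega
          exact_mod_cast this
        rw [h4] at h3
        linarith
      have h3 := ih s hlt
      have h4 : (s : ℝ) + 1 ≤ T := by exact_mod_cast hlt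
      have h5 : u T ^ 2 ≤ (u s + 2 * n * L) ^ 2 := pow_le_pow_left₀ (hnn T) h2 2
      have hn' : (0 : ℝ) ≤ n := Nat.cast_nonneg n
      have h6 : (4 * n * L) * u s ≤ (4 * n * L) * (L * ((T : ℝ) - s)) :=
        mul_le_mul_of_nonneg_left h1 (by positivity)
      have h7 : (2 * n * L) ^ 2 * 1 ≤ (2 * n * L) ^ 2 * ((T : ℝ) - s) :=
        mul_le_mul_of_nonneg_left (by linarith) (sq_nonneg _)
      have h8 : 0 ≤ L ^ 2 * ((T : ℝ) - s) := mul_nonneg (sq_nonneg _) (by linarith)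
      nlinarith

/-! ### Gradient Descent and regret -/

section

variable {n : ℕ} {η : ℝ} {x0 : Fin n → ℝ} {x y : ℕ → Fin n → ℝ}

theorem IsGradientDescent.mem_simplex {A : Matrix (Fin n) (Fin n) ℝ}
    (h : IsGradientDescent A η x0 x y) (hx0 : x0 ∈ simplex n) : ∀ t, x t ∈ simplex n
  | 0 => h.primal_zero ▸ hx0
  | t + 1 => h.primal_mem t

theorem IsGradientDescent.dual_eq {A : Matrix (Fin n) (Fin n) ℝ}
    (h : IsGradientDescent A η x0 x y) (t : ℕ) :
    y t = η • ∑ s ∈ Finset.range t, A *ᵥ x s := by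
  induction t with
  | zero => simp [h.dual_zero]
  | succ t ih => rw [h.dual_succ, ih, Finset.sum_range_succ, smul_add]

variable [NeZero n] {a : Fin n → ℝ}

/-- Both regrets are bounded through the largest coordinate of the cumulative payoff vector. -/
theorem IsGradientDescent.totalRegret_le (hn : 3 ≤ n)
    (h : IsGradientDescent (rpsMatrix a) η x0 x y) (hη : 0 < η) {T : ℕ} {M : ℝ}
    (hM : ∀ k, y (T + 1) k ≤ M) : totalRegret (rpsMatrix a) x x T ≤ 2 * (M / η) := by
  have hne : (simplex n).Nonempty := ⟨_, single_mem_stdSimplex ℝ (0 : Fin n)⟩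
  have key : ∀ u ∈ simplex n,
      ∑ t ∈ Finset.range (T + 1), u ⬝ᵥ (rpsMatrix a *ᵥ x t) ≤ M / η := by
    intro u hu
    rw [le_div_iff₀ hη, mul_comm]
    have h1 : η * ∑ t ∈ Finset.range (T + 1), u ⬝ᵥ (rpsMatrix a *ᵥ x t) = u ⬝ᵥ y (T + 1) := by
      rw [h.dual_eq, dotProduct_smul, dotProduct_sum, smul_eq_mul]
    rw [h1]
    calc u ⬝ᵥ y (T + 1) ≤ ∑ i, u i * M :=
          Finset.sum_le_sum fun i _ => mul_le_mul_of_nonneg_left (hM i) (hu.1 i)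
      _ = M := by rw [← Finset.sum_mul, hu.2, one_mul]
  have h1 : sSup ((fun u : Fin n → ℝ =>
      ∑ t ∈ Finset.range (T + 1), u ⬝ᵥ (rpsMatrix a *ᵥ x t)) '' simplex n) ≤ M / η :=
    csSup_le (hne.image _) (by rintro _ ⟨u, hu, rfl⟩; exact key u hu)
  have h2 : -(M / η) ≤ sInf ((fun u : Fin n → ℝ =>
      ∑ t ∈ Finset.range (T + 1), u ⬝ᵥ ((rpsMatrix a)ᵀ *ᵥ x t)) '' simplex n) := by
    refine le_csInf (hne.image _) ?_
    rintro _ ⟨u, hu, rfl⟩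
    simp only [transpose_rpsMatrix hn, Matrix.neg_mulVec, dotProduct_neg, Finset.sum_neg_distrib]
    exact neg_le_neg (key u hu)
  unfold totalRegret regret₁ regret₂
  linarith

theorem IsGradientDescent.exists_dual_nonpos (hn : 3 ≤ n)
    (h : IsGradientDescent (rpsMatrix a) η x0 x y) (hη : 0 < η) (hx0 : x0 ∈ simplex n) (t : ℕ) :
    ∃ k, y (t + 1) k ≤ 0 := by
  have hx := h.mem_simplex hx0
  have hsum : 0 < ∑ i, (∑ s ∈ Finset.range (t + 1), x s) i := by
    simp only [Finset.sum_apply]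
    rw [Finset.sum_comm]
    simp only [fun s => (hx s).2]
    simp
    positivity
  obtain ⟨k, hk⟩ := exists_mulVec_nonpos hn a (∑ s ∈ Finset.range (t + 1), x s)
    (fun i => by rw [Finset.sum_apply]; exact Finset.sum_nonneg fun s _ => (hx s).1 i) hsum
  refine ⟨k, ?_⟩
  rw [h.dual_eq, ← Matrix.mulVec_sum, Pi.smul_apply, smul_eq_mul]
  exact mul_nonpos_of_nonneg_of_nonpos hη.le hk

/-- If `η γ(x⁰) > 1` then the coordinates of the first dual iterate are more than `1` apart, so that
it is cyclic at its largest coordinate. -/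
theorem IsGradientDescent.exists_cyclic_one (hn : 3 ≤ n)
    (h : IsGradientDescent (rpsMatrix a) η x0 x y) (hη : 0 < η) (hx0 : x0 ∈ simplex n)
    (hγ : 1 < η * gamma a x0) {L : ℝ} (hL : 0 ≤ L) :
    ∃ j, Cyclic L j (y 1) ∧ 0 ≤ y 1 j := by
  have hy : ∀ k, y 1 k = η * (rpsMatrix a *ᵥ x0) k := fun k => by
    have := h.dual_succ 0
    rw [h.dual_zero, h.primal_zero, zero_add, zero_add] at this
    rw [this, Pi.smul_apply, smul_eq_mul]
  obtain ⟨j, hj⟩ := Finite.exists_max (y 1)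
  have hgap : ∀ k, k ≠ j → y 1 k ≤ y 1 j - 1 := by
    intro k hk
    have h1 : gamma a x0 ≤ |(rpsMatrix a *ᵥ x0) j - (rpsMatrix a *ᵥ x0) k| := by
      rw [gamma_eq hn]
      exact ciInf_le (f := fun p : {p : Fin n × Fin n // p.1 ≠ p.2} =>
        |(rpsMatrix a *ᵥ x0) p.1.1 - (rpsMatrix a *ᵥ x0) p.1.2|)
        (Set.finite_range _).bddBelow ⟨(j, k), hk.symm⟩
    have h2 := mul_le_mul_of_nonneg_left h1 hη.le
    have h3 : η * |(rpsMatrix a *ᵥ x0) j - (rpsMatrix a *ᵥ x0) k| = y 1 j - y 1 k := by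
      rw [← abs_of_nonneg (sub_nonneg.2 (hj k)), hy j, hy k, ← mul_sub, abs_mul, abs_of_pos hη]
    linarith
  refine ⟨j, ⟨by linarith [hj (j + 1)], fun k hk _ => hgap k hk⟩, ?_⟩
  obtain ⟨k, hk⟩ := exists_mulVec_nonneg hn a x0 hx0.1 (by rw [hx0.2]; exact one_pos)
  exact le_trans (by rw [hy]; exact mul_nonneg hη.le hk) (hj k)

theorem IsGradientDescent.dual_le (hn : 3 ≤ n) (ha : ∀ i, 0 < a i)
    (h : IsGradientDescent (rpsMatrix a) η x0 x y) (hη : 0 < η) (hx0 : x0 ∈ simplex n)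
    {L : ℝ} (hL : ∀ i, η * a i ≤ L) (hstep : ∀ i, 2 ≤ η * a i)
    (hγ : 1 < η * gamma a x0) (T : ℕ) (k : Fin n) :
    y (T + 1) k ≤ (2 * n + 1) * L * Real.sqrt (T + 1) + L := by
  have hx := h.mem_simplex hx0
  have hL0 : 0 ≤ L := le_trans (by linarith [hstep 0]) (hL 0)
  have hrise : ∀ t k, y (t + 1) k ≤ y t k + L := by
    intro t k
    rw [h.dual_succ, Pi.add_apply, Pi.smul_apply, smul_eq_mul]
    have h1 := mul_le_mul_of_nonneg_left (mulVec_le hn ha (hx t) k) hη.le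
    have h2 := mem_Icc_of_mem_stdSimplex (hx t) (k - 1)
    have h3 := hL (k - 1)
    have h4 := hstep (k - 1)
    nlinarith [h2.1, h2.2]
  obtain ⟨j, hj, hj0⟩ := h.exists_cyclic_one hn hη hx0 hγ hL0
  have hsucc : ∀ m, Fin.ofNat n (m + 1) = Fin.ofNat n m + 1 := by
    intro m; ext; simp [Fin.val_add]
  have hnext : ∀ t m, Cyclic L (Fin.ofNat n m) (y (t + 1)) →
      ∃ m', Cyclic L (Fin.ofNat n m') (y (t + 1 + 1)) ∧
        ((m' = m ∧ y (t + 1 + 1) (Fin.ofNat n m) = y (t + 1) (Fin.ofNat n m)) ∨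
        (m' = m + 1 ∧ y (t + 1) (Fin.ofNat n m) ≤ y (t + 1 + 1) (Fin.ofNat n m') ∧
          y (t + 1 + 1) (Fin.ofNat n m') ≤ y (t + 1) (Fin.ofNat n m) + 2 * L)) := by
    intro t m hm
    have := hm.step hn ha hη hstep hL (h.primal_mem t) (h.primal_max t)
    rw [← h.dual_succ] at this
    rcases this with ⟨h1, h2⟩ | ⟨h1, h2⟩
    · exact ⟨m, h1, Or.inl ⟨rfl, h2⟩⟩
    · refine ⟨m + 1, ?_, Or.inr ⟨rfl, ?_⟩⟩
      · rw [hsucc]; exact h1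
      · rw [hsucc]; exact h2
  choose! next hnext1 hnext2 using hnext
  let c : ℕ → ℕ := fun t => Nat.rec j.val next t
  have hc : ∀ t, Cyclic L (Fin.ofNat n (c t)) (y (t + 1)) := by
    intro t
    induction t with
    | zero => simpa [c] using hj
    | succ t ih => exact hnext1 t (c t) ih
  have h0 : Fin.ofNat n (c 0) = j := by simp [c]
  obtain ⟨h1, h2⟩ := leader_sq_le hL0 (y := fun t => y (t + 1)) (c := c)
    (fun t => hnext2 t (c t) (hc t)) (fun t k => hrise (t + 1) k)
    (fun t => h.exists_dual_nonpos hn hη hx0 t) (by rw [h0]; exact hj0)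
    (by simpa [h.dual_zero] using hrise 0 (Fin.ofNat n (c 0))) T
  have h3 : y (T + 1) (Fin.ofNat n (c T)) ≤ (2 * n + 1) * L * Real.sqrt (T + 1) := by
    refine le_of_sq_le_sq ?_ (by positivity)
    rw [mul_pow, Real.sq_sqrt (by positivity)]
    exact h2
  linarith [(hc T).le hL0 k]

end

end RPS

theorem theorem5p3 (n : ℕ) [NeZero n] (hn : 3 ≤ n) (a : Fin n → ℝ) (ha : ∀ i, 0 < a i) :
    Measure.hausdorffMeasure ((n : ℝ) - 1)
        {x : EuclideanSpace ℝ (Fin n) |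
          x.ofLp ∈ RPS.simplex n ∧ ¬ 0 < RPS.gamma a x.ofLp} = 0 ∧
      ∀ η : ℝ, ∃ C : ℝ, ∀ x0 ∈ RPS.simplex n,
        0 < RPS.gamma a x0 → max (2 / RPS.aMin a) (1 / RPS.gamma a x0) < η →
          ∀ x y : ℕ → Fin n → ℝ, RPS.IsGradientDescent (RPS.rpsMatrix a) η x0 x y →
            ∀ T : ℕ, 1 ≤ T →
              RPS.totalRegret (RPS.rpsMatrix a) x x T ≤ C * Real.sqrt T := by
  refine ⟨RPS.hausdorffMeasure_gamma_eq_zero hn a ha, fun η => ?_⟩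
  obtain ⟨i, hi⟩ := Finite.exists_max a
  refine ⟨2 * (((2 * n + 1) * (η * a i) * 2 + η * a i) / η), fun x0 hx0 hγ hη x y h T hT => ?_⟩
  obtain ⟨hη1, hη2⟩ := max_lt_iff.1 hη
  have hη0 : 0 < η := lt_trans (by positivity) hη2
  have hmin : 0 < RPS.aMin a := by
    obtain ⟨k, hk⟩ := exists_eq_ciInf_of_finite (f := a)
    rw [RPS.aMin, ← hk]; exact ha k
  have hstep : ∀ k, 2 ≤ η * a k := fun k => by
    have h1 := (div_lt_iff₀ hmin).1 hη1
    have h2 : RPS.aMin a ≤ a k := ciInf_le (Set.finite_range a).bddBelow k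
    nlinarith
  have hb := h.dual_le hn ha hη0 hx0 (L := η * a i)
    (fun k => mul_le_mul_of_nonneg_left (hi k) hη0.le) hstep ((div_lt_iff₀ hγ).1 hη2) T
  have hT1 : (1 : ℝ) ≤ T := by exact_mod_cast hT
  have hs1 : 1 ≤ Real.sqrt T := Real.one_le_sqrt.2 hT1
  have hs2 : Real.sqrt (T + 1) ≤ 2 * Real.sqrt T := by
    rw [Real.sqrt_le_left (by positivity), mul_pow, Real.sq_sqrt (by positivity)]
    linarith
  have hL : 0 < η * a i := mul_pos hη0 (ha i)
  refine (h.totalRegret_le hn hη0 (M := ((2 * n + 1) * (η * a i) * 2 + η * a i) * Real.sqrt T)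
    fun k => (hb k).trans ?_).trans_eq (by ring)
  have h1 : (2 * n + 1) * (η * a i) * Real.sqrt (T + 1)
      ≤ (2 * n + 1) * (η * a i) * (2 * Real.sqrt T) :=
    mul_le_mul_of_nonneg_left hs2 (by positivity)
  nlinarith
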